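/- Let $M>1$, $\nu>2$ and $C_0>0$. For integers $p,k\ge 1$ let $\mathcal G_0(M,k)$ be the set of all symmetric real $p\times p$ matrices $\Omega=(\omega_{ab})$ with at most $k$ nonzero entries in each column, $\max_{1\le b\le p}\sum_{a=1}^p 1\{\omega_{ab}\ne 0\}\le k$, and with spectrum bounded by $1/M\le\lambda_{\min}(\Omega)\le\lambda_{\max}(\Omega)\le M$. For $\Omega\in\mathcal G_0(M,k)$ let $\mathbb P_\Omega$ denote the joint distribution of $n$ independent $p$-variate Gaussian vectors $X^{(1)},\dots,X^{(n)}$ with zero mean and precision matrix $\Omega$, that is, $X^{(m)}\sim\mathcal N_p(0,\Omega^{-1})$. Write $\|A\|_\infty=\max_{a,b}|a_{ab}|$ for the entrywise maximum of a matrix $A=(a_{ab})$. Then there are positive constants $c_1,c_2,C_1,C_2,C_1',C_2'$, depending only on $M$, $\nu$ and $C_0$, such that for all integers $n,p,k$ (where $k=k_{n,p}$ may depend on $n$ and $p$) with $$p\ge k^{\nu}\qquad\text{and}\qquad 3\le k\le C_0\frac{n}{\log p},$$ the following two bounds hold. First, for all $1\le i,j\le p$ (including $i=j$), $$\inf_{\hat\omega_{ij}}\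 \sup_{\Omega\in\mathcal G_0(M,k)}\mathbb P_\Omega\left\{|\hat\omega_{ij}-\omega_{ij}|>\max\left\{C_1\frac{k\log p}{n},\,C_2\sqrt{\frac1n}\right\}\right\}>c_1,$$ where the infimum is over all estimators $\hat\omega_{ij}$ of $\omega_{ij}$, i.e. measurable real-valued functions of $(X^{(1)},\dots,X^{(n)})$. Second, $$\inf_{\hat\Omega}\ \sup_{\Omega\in\mathcal G_0(M,k)}\mathbb P_\Omega\left\{\|\hat\Omega-\Omega\|_\infty>\max\left\{C_1'\frac{k\log p}{n},\,C_2'\sqrt{\frac{\log p}{n}}\right\}\right\}>c_2,$$ where the infimum is over all estimators $\hat\Omega$ of $\Omega$, i.e. measurable $p\times p$-matrix-valued functions of $(X^{(1)},\dots,X^{(n)})$. -/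

import Mathlib

open MeasureTheory ProbabilityTheory

noncomputable section

/-- The class `G₀(M, k)` of `p × p` precision matrices: symmetric real matrices with at most `k`
nonzero entries in each column and all eigenvalues in `[1/M, M]`. -/
def sparsePrecisionClass (p : ℕ) (M : ℝ) (k : ℕ) : Set (Matrix (Fin p) (Fin p) ℝ) :=
  {Ω | (∀ j, (Finset.univ.filter fun i => Ω i j ≠ 0).card ≤ k) ∧
    ∃ h : Ω.IsHermitian, ∀ l, 1 / M ≤ h.eigenvalues l ∧ h.eigenvalues l ≤ M}

/-- The joint law of `n` independent `N(0, Ω⁻¹)` observations in `ℝᵖ`. -/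
def sampleLaw (n : ℕ) {p : ℕ} (Ω : Matrix (Fin p) (Fin p) ℝ) :
    Measure (Fin n → EuclideanSpace ℝ (Fin p)) :=
  Measure.pi fun _ => multivariateGaussian 0 Ω⁻¹

/-- The entrywise maximum `max_{a,b} |A a b|`. -/
def entryMaxNorm {p : ℕ} (A : Matrix (Fin p) (Fin p) ℝ) : ℝ :=
  ⨆ ab : Fin p × Fin p, |A ab.1 ab.2|

/-- Estimators of a single entry: measurable real functions of the sample. -/
def EntryEstimator (n p : ℕ) : Type :=
  {f : (Fin n → EuclideanSpace ℝ (Fin p)) → ℝ // Measurable f}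

/-- Estimators of the whole matrix: matrix-valued functions of the sample, all of whose entries
are measurable. -/
def MatrixEstimator (n p : ℕ) : Type :=
  {F : (Fin n → EuclideanSpace ℝ (Fin p)) → Matrix (Fin p) (Fin p) ℝ //
    ∀ a b, Measurable fun x => F x a b}

/-- `inf` over entry estimators of `sup` over `G₀(M, k)` of the probability that the error in
estimating the entry `(i, j)` exceeds `r`. -/
def entryMinimaxProb (n p : ℕ) (M : ℝ) (k : ℕ) (i j : Fin p) (r : ℝ) : ENNReal :=
  ⨅ f : EntryEstimator n p, ⨆ Ω ∈ sparsePrecisionClass p M k,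
    sampleLaw n Ω {x | r < |f.1 x - Ω i j|}

/-- `inf` over matrix estimators of `sup` over `G₀(M, k)` of the probability that the entrywise
maximum error exceeds `r`. -/
def matrixMinimaxProb (n p : ℕ) (M : ℝ) (k : ℕ) (r : ℝ) : ENNReal :=
  ⨅ F : MatrixEstimator n p, ⨆ Ω ∈ sparsePrecisionClass p M k,
    sampleLaw n Ω {x | r < entryMaxNorm (F.1 x - Ω)}

end

open MeasureTheory ProbabilityTheory

open scoped ENNReal

/-! The bounds come from testing the identity precision matrix against a uniform mixture of finitely
many alternatives, with covariance `1 + D` and `D ^ 3 = t • D`. The cubic relation makes the inverse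
explicit, `1 - (D - D²) / (1 - t)`, and confines its spectrum to `[1/M, M]` for small `t`. If the
mixture of likelihood ratios has bounded second moment under the null, no test succeeds
(`le_error_of_mixture_second_moment`); an estimator accurate on null and alternatives would be such
a test. The cross moments reduce to `det (1 - D₁ D₂)⁻¹` (`det_perturbedPrecision_ratio`).

For the rate `k log p / n`, take `D = a (u wᵀ + w uᵀ)` with `u` the indicator of `{i, j}`, `w` the
indicator of `k - 2` unknown coordinates and `a² ≍ log p / n`. The covariance entry `(i, j)` does
not move, but the `D²` term moves the precision entry by about `a² (k - 2)`. Choosing one coordinate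
of `w` in each of `m` blocks of size `B` makes overlaps independent over blocks, so the moment is at
most `exp (m e^y / B)` with `y ≍ n a²` (`blockFamily`). Since `k² ≤ p^(2/ν)` and `ν > 2`, a small
multiple of `log p` is affordable for `y` (`block_size_bound`).

One alternative with `a ≍ n^(-1/2)` gives the parametric rate; one unknown position for `w` gives
`√(log p / n)`. A maximum of two rates equals one of them, so each may be treated separately. -/

/-! ### Gaussian likelihood ratios and their cross moments -/

theorem lintegral_pi_prod {n : ℕ} {E : Type*} [MeasurableSpace E] {μ : Fin n → Measure E}
    [∀ i, SigmaFinite (μ i)] {f : Fin n → E → ℝ≥0∞} (hf : ∀ i, Measurable (f i)) :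
    ∫⁻ x : Fin n → E, ∏ i, f i (x i) ∂(Measure.pi μ) = ∏ i, ∫⁻ x, f i x ∂(μ i) := by
  induction n with
  | zero => simp
  | succ n ih =>
    rw [((measurePreserving_piFinSuccAbove μ 0).symm).lintegral_map_equiv]
    simp_rw [MeasurableEquiv.piFinSuccAbove_symm_apply, Fin.insertNthEquiv,
      Fin.prod_univ_succ, Fin.insertNth_zero, Equiv.coe_fn_mk, Fin.cons_succ,
      Fin.zero_succAbove, Fin.cons_zero]
    rw [← ih (μ := fun i => μ i.succ) fun i : Fin n => hf i.succ]
    exact lintegral_prod_mul (hf 0).aemeasurable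
      (Finset.measurable_prod _ fun (i : Fin n) _ =>
        (hf i.succ).comp (measurable_pi_apply i)).aemeasurable

theorem pi_withDensity {n : ℕ} {E : Type*} [MeasurableSpace E] {μ : Measure E}
    [SigmaFinite μ] {f : E → ℝ≥0∞} (hf : Measurable f) [SigmaFinite (μ.withDensity f)] :
    Measure.pi (fun _ : Fin n => μ.withDensity f) =
      (Measure.pi fun _ : Fin n => μ).withDensity fun x => ∏ i, f (x i) := by
  refine Measure.pi_eq fun s hs => ?_
  rw [withDensity_apply _ (MeasurableSet.univ_pi hs), Measure.restrict_pi_pi,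
    lintegral_pi_prod fun _ => hf]
  exact Finset.prod_congr rfl fun i _ => (withDensity_apply _ (hs i)).symm

theorem map_withDensity_comp {α β : Type*} [MeasurableSpace α] [MeasurableSpace β]
    {μ : Measure α} {g : α → β} (hg : Measurable g) {f : β → ℝ≥0∞} (hf : Measurable f) :
    (μ.withDensity (f ∘ g)).map g = (μ.map g).withDensity f := by
  ext s hs
  rw [Measure.map_apply hg hs, withDensity_apply _ (hg hs), withDensity_apply _ hs,
    setLIntegral_map hs hf hg]
  rfl

/-- The density of the standard Gaussian measure on `ℝᵖ`. -/
theorem stdGaussian_eq_withDensity (p : ℕ) :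
    stdGaussian (EuclideanSpace ℝ (Fin p)) = volume.withDensity fun x =>
      ENNReal.ofReal ((Real.sqrt (2 * Real.pi))⁻¹ ^ p * Real.exp (-‖x‖ ^ 2 / 2)) := by
  rw [← map_pi_eq_stdGaussian]
  have h1 : gaussianReal 0 1 = volume.withDensity (gaussianPDF 0 1) :=
    gaussianReal_of_var_ne_zero 0 one_ne_zero
  have : SigmaFinite ((volume : Measure ℝ).withDensity (gaussianPDF 0 1)) := by
    rw [← h1]; infer_instance
  rw [h1, pi_withDensity (measurable_gaussianPDF 0 1)]
  rw [← (PiLp.volume_preserving_toLp (Fin p)).map_eq, ← map_withDensity_comp (by fun_prop)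
    (by fun_prop)]
  congr 2
  ext x
  simp only [gaussianPDF, gaussianPDFReal, Function.comp]
  rw [← ENNReal.ofReal_prod_of_nonneg fun i _ => by positivity]
  simp [Finset.prod_mul_distrib, ← Real.exp_sum, EuclideanSpace.norm_sq_eq, Finset.sum_div,
    neg_div]

open Matrix in
/-- The density of a centred Gaussian measure with precision matrix `A`, relative to the standard
Gaussian measure. -/
noncomputable def gaussianRatio {p : ℕ} (A : Matrix (Fin p) (Fin p) ℝ)
    (x : EuclideanSpace ℝ (Fin p)) : ℝ≥0∞ :=
  ENNReal.ofReal (Real.sqrt A.det * Real.exp (-(x.ofLp ⬝ᵥ (A - 1) *ᵥ x.ofLp) / 2))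

theorem measurable_gaussianRatio {p : ℕ} (A : Matrix (Fin p) (Fin p) ℝ) :
    Measurable (gaussianRatio A) := by
  unfold gaussianRatio Matrix.mulVec dotProduct
  fun_prop

-- Push the standard density forward along `R = A^(-1/2)`: the identity `R A R = 1` turns `‖x‖²`
-- into the quadratic form of `A`, and the Jacobian is `|det R|⁻¹ = √(det A)`.
open Matrix MatrixOrder in
theorem multivariateGaussian_inv_eq_withDensity {p : ℕ} {A : Matrix (Fin p) (Fin p) ℝ}
    (hA : A.PosDef) :
    multivariateGaussian 0 A⁻¹ =
      (stdGaussian (EuclideanSpace ℝ (Fin p))).withDensity (gaussianRatio A) := by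
  set R : Matrix (Fin p) (Fin p) ℝ := CFC.sqrt A⁻¹ with hR
  have hRR : R * R = A⁻¹ := CFC.sqrt_mul_sqrt_self _ hA.inv.posSemidef.nonneg
  have hRt : Rᵀ = R := by
    have := (CFC.sqrt_nonneg A⁻¹).isSelfAdjoint
    simpa [IsSelfAdjoint, star_eq_conjTranspose] using this
  have hRAR : R * A * R = 1 := by
    have h1 : IsUnit A.det := hA.det_pos.ne'.isUnit
    have h2 : (R * A) * R = 1 ↔ R * (R * A) = 1 := mul_eq_one_comm
    rw [h2, ← mul_assoc, hRR, nonsing_inv_mul _ h1]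
  have hdet : R.det ^ 2 = A.det⁻¹ := by
    rw [sq, ← det_mul, hRR, det_nonsing_inv, Ring.inverse_eq_inv']
  have hdet0 : R.det ≠ 0 := by
    intro h
    rw [h] at hdet
    have := hA.det_pos
    have : 0 < A.det⁻¹ := by positivity
    simp at hdet
    linarith
  have hLdet : LinearMap.det ((toEuclideanCLM (n := Fin p) (𝕜 := ℝ) R :
      EuclideanSpace ℝ (Fin p) →L[ℝ] _) : EuclideanSpace ℝ (Fin p) →ₗ[ℝ] _) = R.det := by
    rw [coe_toEuclideanCLM_eq_toEuclideanLin, toEuclideanLin_eq_toLin_orthonormal,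
      LinearMap.det_toLin]
  have hc : |R.det⁻¹| = Real.sqrt A.det := by
    rw [← Real.sqrt_sq_eq_abs, inv_pow, hdet, inv_inv]
  unfold multivariateGaussian
  simp only [zero_add]
  rw [stdGaussian_eq_withDensity, ← hR]
  have hcomp : (fun x : EuclideanSpace ℝ (Fin p) =>
      ENNReal.ofReal ((Real.sqrt (2 * Real.pi))⁻¹ ^ p * Real.exp (-‖x‖ ^ 2 / 2))) =
      (fun x => ENNReal.ofReal ((Real.sqrt (2 * Real.pi))⁻¹ ^ p *
        Real.exp (-(x.ofLp ⬝ᵥ A *ᵥ x.ofLp) / 2))) ∘ toEuclideanCLM (n := Fin p) (𝕜 := ℝ) R := by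
    ext x
    simp only [Function.comp, ofLp_toEuclideanCLM]
    have : (R *ᵥ x.ofLp) ⬝ᵥ A *ᵥ (R *ᵥ x.ofLp) = ‖x‖ ^ 2 := by
      rw [EuclideanSpace.real_norm_sq_eq]
      have : (R *ᵥ x.ofLp) = x.ofLp ᵥ* R := by
        rw [← vecMul_transpose, hRt]
      rw [this, ← dotProduct_mulVec, ← this, mulVec_mulVec, mulVec_mulVec, hRAR,
        one_mulVec]
      simp [dotProduct, sq]
    rw [this]
  have hmeas : Measurable (fun x : EuclideanSpace ℝ (Fin p) =>
      ENNReal.ofReal ((Real.sqrt (2 * Real.pi))⁻¹ ^ p *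
        Real.exp (-(x.ofLp ⬝ᵥ A *ᵥ x.ofLp) / 2))) := by
    unfold Matrix.mulVec dotProduct
    fun_prop
  rw [hcomp, map_withDensity_comp (by fun_prop) hmeas]
  have hmap := Measure.map_linearMap_addHaar_eq_smul_addHaar
    (volume : Measure (EuclideanSpace ℝ (Fin p)))
    (f := (toEuclideanCLM (n := Fin p) (𝕜 := ℝ) R).toLinearMap) (by rwa [hLdet])
  rw [hLdet, hc] at hmap
  have hmap' : Measure.map (toEuclideanCLM (n := Fin p) (𝕜 := ℝ) R) volume =
    ENNReal.ofReal (Real.sqrt A.det) • (volume : Measure (EuclideanSpace ℝ (Fin p))) := hmap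
  rw [hmap', withDensity_smul_measure, ← hcomp, ← withDensity_mul _ (by fun_prop)
    (measurable_gaussianRatio A), ← withDensity_smul _ hmeas]
  congr 1
  ext x
  simp only [Pi.smul_apply, Pi.mul_apply, smul_eq_mul, gaussianRatio]
  rw [← ENNReal.ofReal_mul (by positivity), ← ENNReal.ofReal_mul (by positivity)]
  congr 1
  have : (x.ofLp ⬝ᵥ (A - 1) *ᵥ x.ofLp) = x.ofLp ⬝ᵥ A *ᵥ x.ofLp - ‖x‖ ^ 2 := by
    rw [sub_mulVec, one_mulVec, dotProduct_sub, EuclideanSpace.real_norm_sq_eq]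
    simp [dotProduct, sq]
  rw [this, show -(x.ofLp ⬝ᵥ A *ᵥ x.ofLp) / 2 =
    -‖x‖ ^ 2 / 2 + -(x.ofLp ⬝ᵥ A *ᵥ x.ofLp - ‖x‖ ^ 2) / 2 by ring, Real.exp_add]
  ring

theorem lintegral_gaussianRatio {p : ℕ} {A : Matrix (Fin p) (Fin p) ℝ} (hA : A.PosDef) :
    ∫⁻ x, gaussianRatio A x ∂(stdGaussian (EuclideanSpace ℝ (Fin p))) = 1 := by
  have h := multivariateGaussian_inv_eq_withDensity hA
  have h1 : multivariateGaussian 0 A⁻¹ Set.univ = 1 := measure_univ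
  rwa [h, withDensity_apply _ MeasurableSet.univ, Measure.restrict_univ] at h1

-- The exponents add, and `(A - 1) + (B - 1) = (A + B - 1) - 1`, so up to normalisation the product
-- is again a Gaussian ratio and integrates explicitly.
open Matrix in
theorem gaussianRatio_mul_gaussianRatio {p : ℕ} {A B : Matrix (Fin p) (Fin p) ℝ}
    (hA : A.PosDef) (hB : B.PosDef) (hAB : (A + B - 1).PosDef) (x : EuclideanSpace ℝ (Fin p)) :
    gaussianRatio A x * gaussianRatio B x =
      ENNReal.ofReal (Real.sqrt (A.det * B.det / (A + B - 1).det)) *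
        gaussianRatio (A + B - 1) x := by
  have h := hAB.det_pos
  unfold gaussianRatio
  rw [← ENNReal.ofReal_mul (by positivity), ← ENNReal.ofReal_mul (by positivity)]
  congr 1
  have h2 : Real.sqrt (A.det * B.det / (A + B - 1).det) * Real.sqrt (A + B - 1).det =
      Real.sqrt A.det * Real.sqrt B.det := by
    rw [← Real.sqrt_mul (div_nonneg (mul_nonneg hA.det_pos.le hB.det_pos.le) h.le),
      div_mul_cancel₀ _ h.ne', Real.sqrt_mul hA.det_pos.le]
  rw [← mul_assoc (Real.sqrt (_ / _)), h2, mul_mul_mul_comm, ← Real.exp_add]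
  congr 2
  rw [show A + B - 1 - 1 = (A - 1) + (B - 1) by abel, add_mulVec, dotProduct_add]
  ring

/-- The likelihood ratio of `n` independent centred Gaussian vectors with precision matrix `A`,
relative to `n` standard Gaussian vectors. -/
noncomputable def sampleRatio (n : ℕ) {p : ℕ} (A : Matrix (Fin p) (Fin p) ℝ)
    (x : Fin n → EuclideanSpace ℝ (Fin p)) : ℝ≥0∞ :=
  ∏ i, gaussianRatio A (x i)

theorem measurable_sampleRatio (n : ℕ) {p : ℕ} (A : Matrix (Fin p) (Fin p) ℝ) :
    Measurable (sampleRatio n A) :=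
  Finset.measurable_prod _ fun i _ => (measurable_gaussianRatio A).comp (measurable_pi_apply i)

instance isProbabilityMeasure_sampleLaw (n : ℕ) {p : ℕ} (A : Matrix (Fin p) (Fin p) ℝ) :
    IsProbabilityMeasure (sampleLaw n A) := by
  unfold sampleLaw; infer_instance

theorem sampleLaw_one (n p : ℕ) : sampleLaw n (1 : Matrix (Fin p) (Fin p) ℝ) =
    Measure.pi fun _ => stdGaussian (EuclideanSpace ℝ (Fin p)) := by
  simp [sampleLaw]

theorem sampleLaw_eq_withDensity (n : ℕ) {p : ℕ} {A : Matrix (Fin p) (Fin p) ℝ}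
    (hA : A.PosDef) :
    sampleLaw n A = (sampleLaw n (1 : Matrix (Fin p) (Fin p) ℝ)).withDensity (sampleRatio n A) := by
  have h := multivariateGaussian_inv_eq_withDensity hA
  have : SigmaFinite ((stdGaussian (EuclideanSpace ℝ (Fin p))).withDensity (gaussianRatio A)) := by
    rw [← h]; infer_instance
  rw [sampleLaw_one, sampleLaw, h, pi_withDensity (measurable_gaussianRatio A)]
  rfl

theorem lintegral_sampleRatio_mul (n : ℕ) {p : ℕ} {A B : Matrix (Fin p) (Fin p) ℝ}
    (hA : A.PosDef) (hB : B.PosDef) (hAB : (A + B - 1).PosDef) :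
    ∫⁻ x, sampleRatio n A x * sampleRatio n B x ∂(sampleLaw n (1 : Matrix (Fin p) (Fin p) ℝ)) =
      ENNReal.ofReal (Real.sqrt (A.det * B.det / (A + B - 1).det) ^ n) := by
  have h : ∀ x : Fin n → EuclideanSpace ℝ (Fin p), sampleRatio n A x * sampleRatio n B x =
      ∏ i, ENNReal.ofReal (Real.sqrt (A.det * B.det / (A + B - 1).det)) *
        gaussianRatio (A + B - 1) (x i) := fun x => by
    rw [sampleRatio, sampleRatio, ← Finset.prod_mul_distrib]
    exact Finset.prod_congr rfl fun i _ => gaussianRatio_mul_gaussianRatio hA hB hAB (x i)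
  simp_rw [h]
  rw [sampleLaw_one, lintegral_pi_prod
    fun _ => (measurable_gaussianRatio (A + B - 1)).const_mul _]
  rw [lintegral_const_mul _ (measurable_gaussianRatio _), lintegral_gaussianRatio hAB]
  simp [ENNReal.ofReal_pow]

/-! ### Second-moment bound for testing against a mixture -/

theorem ENNReal.le_mul_self_mul_add {c d : ℝ} (hc : 0 < c) (hd : 0 < d) (hcd : 4 * c * d = 1)
    (y : ℝ≥0∞) : y ≤ ENNReal.ofReal c * (y * y) + ENNReal.ofReal d := by
  induction y with
  | top => simp [ENNReal.mul_top, hc]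
  | coe y =>
    rw [← ENNReal.ofReal_coe_nnreal, ← ENNReal.ofReal_mul (NNReal.coe_nonneg y), ← ENNReal.ofReal_mul hc.le,
      ← ENNReal.ofReal_add (by positivity) hd.le]
    refine ENNReal.ofReal_le_ofReal ?_
    have h : c * ((y : ℝ) * y) + d - y = c * ((y : ℝ) - 2 * d) ^ 2 := by
      linear_combination ((y : ℝ) - d) * hcd
    have := mul_nonneg hc.le (sq_nonneg ((y : ℝ) - 2 * d))
    linarith

/-- If the uniform mixture of the densities `ℓ t` has second moment at most `K`, then no event
can separate the reference measure from all of them with both error probabilities below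
`1 / (4K)`. -/
theorem le_error_of_mixture_second_moment {X T : Type*} [MeasurableSpace X] [Fintype T]
    [Nonempty T] {μ : Measure X} {ℓ : T → X → ℝ≥0∞} (hℓ : ∀ t, Measurable (ℓ t))
    (hprob : ∀ t, ∫⁻ x, ℓ t x ∂μ = 1) {K : ℝ} (hK : 1 ≤ K)
    (hsum : ∑ s, ∑ t, ∫⁻ x, ℓ s x * ℓ t x ∂μ ≤ ENNReal.ofReal ((Fintype.card T : ℝ) ^ 2 * K))
    {A : Set X} (hA : MeasurableSet A) {e : ℝ≥0∞} (h0 : μ A ≤ e)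
    (h1 : ∀ t, μ.withDensity (ℓ t) Aᶜ ≤ e) : ENNReal.ofReal (1 / (4 * K)) ≤ e := by
  by_contra! hlt
  obtain ⟨N, hN⟩ : ∃ N : ℝ, N = Fintype.card T := ⟨_, rfl⟩
  have hNpos : 0 < N := by rw [hN]; exact_mod_cast Fintype.card_pos
  have hK0 : 0 < K := by linarith
  have he : e ≠ ∞ := hlt.ne_top
  obtain ⟨e', he', rfl⟩ : ∃ e' : ℝ, 0 ≤ e' ∧ e = ENNReal.ofReal e' :=
    ⟨e.toReal, ENNReal.toReal_nonneg, (ENNReal.ofReal_toReal he).symm⟩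
  have hlt' : e' < 1 / (4 * K) := (ENNReal.ofReal_lt_ofReal_iff (by positivity)).1 hlt
  have hg : Measurable fun x => ∑ t, ℓ t x := Finset.measurable_sum _ fun t _ => hℓ t
  have hgg : Measurable fun x => (∑ t, ℓ t x) * ∑ t, ℓ t x := hg.mul hg
  have hm : ∀ s t, Measurable fun x => ℓ s x * ℓ t x := fun s t => (hℓ s).mul (hℓ t)
  have hsq : ∫⁻ x, (∑ t, ℓ t x) * (∑ t, ℓ t x) ∂μ ≤ ENNReal.ofReal (N ^ 2 * K) := by
    rw [hN]
    refine le_trans (le_of_eq ?_) hsum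
    simp_rw [Finset.sum_mul_sum]
    rw [lintegral_finsetSum _ fun s _ => Finset.measurable_sum _ fun t _ => hm s t]
    exact Finset.sum_congr rfl fun s _ =>
      lintegral_finsetSum _ fun t _ => hm s t
  -- A linearised Cauchy–Schwarz inequality: the weights `1 / (4KN)` and `KN` turn the moment bound
  -- `N² K` into `N / 4`, leaving `KN` times the null error.
  have hmain : ∫⁻ x in A, ∑ t, ℓ t x ∂μ ≤ ENNReal.ofReal (N / 4 + K * N * e') := by
    calc ∫⁻ x in A, ∑ t, ℓ t x ∂μ
        ≤ ∫⁻ x in A, (ENNReal.ofReal (1 / (4 * (K * N))) * ((∑ t, ℓ t x) * (∑ t, ℓ t x)) +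
            ENNReal.ofReal (K * N)) ∂μ :=
          lintegral_mono fun x => ENNReal.le_mul_self_mul_add (by positivity) (by positivity)
            (by field_simp) _
      _ = ENNReal.ofReal (1 / (4 * (K * N))) * ∫⁻ x in A, (∑ t, ℓ t x) * (∑ t, ℓ t x) ∂μ +
            ENNReal.ofReal (K * N) * μ A := by
          rw [lintegral_add_right _ measurable_const, lintegral_const_mul _ hgg]
          simp
      _ ≤ ENNReal.ofReal (1 / (4 * (K * N))) * ENNReal.ofReal (N ^ 2 * K) +
            ENNReal.ofReal (K * N) * ENNReal.ofReal e' := by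
          gcongr
          exact (setLIntegral_le_lintegral _ _).trans hsq
      _ = ENNReal.ofReal (N / 4 + K * N * e') := by
          rw [← ENNReal.ofReal_mul (by positivity), ← ENNReal.ofReal_mul (by positivity),
            ← ENNReal.ofReal_add (by positivity) (by positivity)]
          congr 1
          field_simp
  -- The total mass `N` of the alternatives splits over `A` and its complement. With `e' < 1 / (4K)`
  -- the three contributions are each at most `N / 4`, too little to reach `N`.
  have htot : ENNReal.ofReal N ≤ ENNReal.ofReal (N / 4 + K * N * e') + ENNReal.ofReal (N * e') := by
    calc ENNReal.ofReal N = ∑ t : T, (1 : ℝ≥0∞) := by simp [hN]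
      _ = ∑ t, (∫⁻ x in A, ℓ t x ∂μ + μ.withDensity (ℓ t) Aᶜ) := by
          refine Finset.sum_congr rfl fun t _ => ?_
          rw [withDensity_apply _ hA.compl, lintegral_add_compl _ hA, hprob]
      _ ≤ ∑ t, (∫⁻ x in A, ℓ t x ∂μ + ENNReal.ofReal e') :=
          Finset.sum_le_sum fun t _ => add_le_add le_rfl (h1 t)
      _ = ∫⁻ x in A, ∑ t, ℓ t x ∂μ + ENNReal.ofReal (N * e') := by
          rw [Finset.sum_add_distrib, lintegral_finsetSum _ fun t _ => hℓ t,
            ENNReal.ofReal_mul hNpos.le]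
          simp [hN]
      _ ≤ _ := by gcongr
  rw [← ENNReal.ofReal_add (by positivity) (by positivity),
    ENNReal.ofReal_le_ofReal_iff (by positivity)] at htot
  have h4 : K * e' < 1 / 4 := by
    rw [lt_div_iff₀ (by positivity)] at hlt'
    linarith
  have h5 : e' ≤ K * e' := le_mul_of_one_le_left he' hK
  nlinarith

/-! ### Algebra and spectrum of the perturbed precision matrices -/

/-- If `D ^ 3 = t • D`, this is the inverse of `1 + D`. -/
noncomputable def perturbedPrecision {p : ℕ} (t : ℝ) (D : Matrix (Fin p) (Fin p) ℝ) :
    Matrix (Fin p) (Fin p) ℝ :=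
  1 - (1 - t)⁻¹ • (D - D * D)

section

open Matrix

variable {p : ℕ} {t : ℝ} {D D₁ D₂ : Matrix (Fin p) (Fin p) ℝ}

theorem one_add_mul_perturbedPrecision (ht : t ≠ 1) (hD : D * D * D = t • D) :
    (1 + D) * perturbedPrecision t D = 1 := by
  have h : (1 + D) * (D - D * D) = (1 - t) • D := by
    rw [sub_smul, ← hD, one_smul]; noncomm_ring
  have h1 : (1 - t) ≠ 0 := sub_ne_zero.2 ht.symm
  rw [perturbedPrecision, mul_sub, mul_smul_comm, h, smul_smul, inv_mul_cancel₀ h1, one_smul]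
  simp

theorem isHermitian_perturbedPrecision (hs : D.IsHermitian) :
    (perturbedPrecision t D).IsHermitian := by
  have h : (D * D).IsHermitian := by
    rw [IsHermitian, conjTranspose_mul, hs.eq]
  unfold perturbedPrecision IsHermitian
  rw [conjTranspose_sub, conjTranspose_smul, conjTranspose_sub, hs.eq, h.eq]
  simp

/-- Coordinatewise `x y - y² ≤ x² / 4` bounds `D - D²` by `1/4`, and `(1 - t)⁻¹ ≤ 4/3`. Any constant
above `1/2` would make `A + B - 1` positive definite. -/
theorem two_thirds_le_perturbedPrecision (ht : t ≤ 1 / 4) (hs : D.IsHermitian) (x : Fin p → ℝ) :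
    2 / 3 * (x ⬝ᵥ x) ≤ x ⬝ᵥ perturbedPrecision t D *ᵥ x := by
  have h1 : x ⬝ᵥ perturbedPrecision t D *ᵥ x =
      x ⬝ᵥ x - (1 - t)⁻¹ * (x ⬝ᵥ D *ᵥ x - (D *ᵥ x) ⬝ᵥ (D *ᵥ x)) := by
    have : x ⬝ᵥ (D * D) *ᵥ x = (D *ᵥ x) ⬝ᵥ (D *ᵥ x) := by
      have hDx : D *ᵥ x = x ᵥ* D := by
        have : Dᵀ = D := by
          simpa [IsHermitian, conjTranspose_eq_transpose_of_trivial] using hs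
        rw [← vecMul_transpose, this]
      rw [← mulVec_mulVec, dotProduct_mulVec, ← hDx]
    rw [perturbedPrecision, sub_mulVec, smul_mulVec, sub_mulVec, one_mulVec, dotProduct_sub,
      dotProduct_smul, dotProduct_sub, this, smul_eq_mul]
  have h2 : x ⬝ᵥ D *ᵥ x - (D *ᵥ x) ⬝ᵥ (D *ᵥ x) ≤ 1 / 4 * (x ⬝ᵥ x) := by
    simp only [dotProduct, Finset.mul_sum, ← Finset.sum_sub_distrib]
    refine Finset.sum_le_sum fun i _ => ?_
    nlinarith [sq_nonneg ((D *ᵥ x) i - x i / 2)]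
  have h3 : (1 - t)⁻¹ ≤ 4 / 3 := by
    rw [inv_le_comm₀ (by linarith) (by norm_num)]; linarith
  have h4 : 0 ≤ (1 - t)⁻¹ := inv_nonneg.2 (by linarith)
  have h5 : 0 ≤ x ⬝ᵥ x := Finset.sum_nonneg fun i _ => mul_self_nonneg _
  rw [h1]
  nlinarith [mul_le_mul_of_nonneg_left h2 h4]

theorem posDef_perturbedPrecision (ht : t ≤ 1 / 4) (hs : D.IsHermitian) :
    (perturbedPrecision t D).PosDef := by
  refine PosDef.of_dotProduct_mulVec_pos (isHermitian_perturbedPrecision hs) fun x hx => ?_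
  have h1 : 0 < x ⬝ᵥ x := by simpa using dotProduct_star_self_pos_iff.2 hx
  have := two_thirds_le_perturbedPrecision ht hs x
  rw [star_trivial]
  linarith

theorem posDef_perturbedPrecision_add_sub_one (ht : t ≤ 1 / 4) (hs₁ : D₁.IsHermitian)
    (hs₂ : D₂.IsHermitian) :
    (perturbedPrecision t D₁ + perturbedPrecision t D₂ - 1).PosDef := by
  refine PosDef.of_dotProduct_mulVec_pos (((isHermitian_perturbedPrecision hs₁).add
    (isHermitian_perturbedPrecision hs₂)).sub isHermitian_one) fun x hx => ?_
  have h1 : 0 < x ⬝ᵥ x := by simpa using dotProduct_star_self_pos_iff.2 hx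
  have h2 := two_thirds_le_perturbedPrecision ht hs₁ x
  have h3 := two_thirds_le_perturbedPrecision ht hs₂ x
  rw [star_trivial, sub_mulVec, add_mulVec, one_mulVec, dotProduct_sub, dotProduct_add]
  linarith

/-- With `A` and `B` the inverses of `1 + D₁` and `1 + D₂`, the product `(1 + D₁) (A + B - 1) (1 +
D₂)` collapses to `1 - D₁ D₂`; take determinants. -/
theorem det_perturbedPrecision_ratio (ht : t ≤ 1 / 4) (hs₁ : D₁.IsHermitian)
    (hs₂ : D₂.IsHermitian) (hD₁ : D₁ * D₁ * D₁ = t • D₁) (hD₂ : D₂ * D₂ * D₂ = t • D₂) :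
    (perturbedPrecision t D₁).det * (perturbedPrecision t D₂).det /
      (perturbedPrecision t D₁ + perturbedPrecision t D₂ - 1).det = ((1 - D₁ * D₂).det)⁻¹ := by
  have ht1 : t ≠ 1 := by linarith
  have h1 := one_add_mul_perturbedPrecision ht1 hD₁
  have h2 := one_add_mul_perturbedPrecision ht1 hD₂
  have h2' := mul_eq_one_comm.1 h2
  have hp := (posDef_perturbedPrecision_add_sub_one ht hs₁ hs₂).det_pos
  have p1 := (posDef_perturbedPrecision ht hs₁).det_pos
  have p2 := (posDef_perturbedPrecision ht hs₂).det_pos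
  have hm : (1 + D₁) * (perturbedPrecision t D₁ + perturbedPrecision t D₂ - 1) * (1 + D₂) =
      1 - D₁ * D₂ := by
    rw [mul_sub, mul_add _ (perturbedPrecision t D₁), h1, sub_mul, add_mul 1, mul_assoc _ (perturbedPrecision t D₂), h2']
    noncomm_ring
  have d1 : (1 + D₁).det * (perturbedPrecision t D₁).det = 1 := by rw [← det_mul, h1, det_one]
  have d2 : (1 + D₂).det * (perturbedPrecision t D₂).det = 1 := by rw [← det_mul, h2, det_one]
  rw [← hm, det_mul, det_mul]
  rw [eq_inv_of_mul_eq_one_left d1, eq_inv_of_mul_eq_one_left d2]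
  field_simp

/-- Multiplying the eigenvector equation by `1 + D` gives `lam D w = (1 - lam) w`. Iterating and
using `D ^ 3 = t • D` yields `lam = 1` or `(1 - lam)² = t lam²`, whence `|1 - lam| ≤ (1 - 1/M)
|lam|`. -/
theorem eigenvalue_perturbedPrecision_mem {M lam : ℝ} (hM : 1 < M)
    (ht : t ≤ (1 - 1 / M) ^ 2) (hD : D * D * D = t • D) {w : Fin p → ℝ} (hw : w ≠ 0)
    (h : perturbedPrecision t D *ᵥ w = lam • w) : 1 / M ≤ lam ∧ lam ≤ M := by
  have hM0 : 0 < M := by linarith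
  have hM1 : 0 < 1 / M := by positivity
  have hM2 : 1 / M < 1 := by rw [div_lt_one hM0]; exact hM
  have ht1 : t ≠ 1 := by nlinarith
  have h1 : lam • (D *ᵥ w) = (1 - lam) • w := by
    have := congrArg (fun y => (1 + D) *ᵥ y) h
    simp only [mulVec_mulVec, one_add_mul_perturbedPrecision ht1 hD, one_mulVec, mulVec_smul,
      add_mulVec, smul_add] at this
    rw [sub_smul, one_smul]
    exact eq_sub_of_add_eq' this.symm
  have h2 : lam ^ 2 • (D *ᵥ (D *ᵥ w)) = (1 - lam) ^ 2 • w := by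
    rw [sq, mul_smul, ← mulVec_smul, h1, mulVec_smul, smul_comm, h1, smul_smul, sq]
  have h3 : lam ^ 3 • (D *ᵥ (D *ᵥ (D *ᵥ w))) = (1 - lam) ^ 3 • w := by
    rw [pow_succ, mul_comm, mul_smul, ← mulVec_smul, h2, mulVec_smul, smul_comm, h1, smul_smul,
      ← pow_succ]
  have h4 : (lam ^ 2 * t * (1 - lam)) • w = (1 - lam) ^ 3 • w := by
    rw [← h3, mulVec_mulVec, mulVec_mulVec, hD, smul_mulVec, mul_smul, ← h1,
      smul_smul, smul_smul]
    ring_nf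
  have h5 : lam ^ 2 * t * (1 - lam) = (1 - lam) ^ 3 := smul_left_injective ℝ hw h4
  have h6 : lam = 1 ∨ (1 - lam) ^ 2 = t * lam ^ 2 := by
    by_cases h : 1 - lam = 0
    · left; linarith
    · right
      apply mul_right_cancel₀ h
      linear_combination -h5
  rcases h6 with rfl | h6
  · exact ⟨hM2.le, hM.le⟩
  set s := 1 - 1 / M with hs
  have hsM : (1 - s) * M = 1 := by rw [hs]; field_simp; ring
  have hs0 : 0 < s := by rw [hs]; linarith
  have hs1 : s < 1 := by rw [hs]; linarith
  have h7 : (1 - lam) ^ 2 ≤ (s * lam) ^ 2 := by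
    rw [h6, mul_pow]; exact mul_le_mul_of_nonneg_right ht (sq_nonneg _)
  have h8 : |1 - lam| ≤ s * |lam| := by
    have := sq_le_sq.1 h7
    rwa [abs_mul, abs_of_pos hs0] at this
  have h9 : 0 < lam := by
    by_contra! hl
    rw [abs_of_nonpos hl, abs_of_nonneg (by linarith)] at h8
    nlinarith
  rw [abs_of_pos h9, abs_le] at h8
  constructor
  · have : 1 / M = 1 - s := by rw [hs]; ring
    rw [this]
    nlinarith
  · nlinarith

theorem perturbedPrecision_mem {M : ℝ} {k : ℕ} (hM : 1 < M)
    (ht : t ≤ (1 - 1 / M) ^ 2) (hs : D.IsHermitian) (hD : D * D * D = t • D)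
    (hk : ∀ j, (Finset.univ.filter fun i => perturbedPrecision t D i j ≠ 0).card ≤ k) :
    perturbedPrecision t D ∈ sparsePrecisionClass p M k := by
  refine ⟨hk, isHermitian_perturbedPrecision hs, fun l => ?_⟩
  refine eigenvalue_perturbedPrecision_mem hM ht hD
    (w := ((isHermitian_perturbedPrecision hs).eigenvectorBasis l).ofLp) ?_
    ((isHermitian_perturbedPrecision hs).mulVec_eigenvectorBasis l)
  intro h0
  have := (isHermitian_perturbedPrecision (t := t) hs).eigenvectorBasis.toBasis.ne_zero l
  apply this
  ext i
  simpa using congrFun h0 i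

theorem one_mem_sparsePrecisionClass {M : ℝ} {k : ℕ} (hM : 1 < M) (hk : 1 ≤ k) :
    (1 : Matrix (Fin p) (Fin p) ℝ) ∈ sparsePrecisionClass p M k := by
  have h : (1 : Matrix (Fin p) (Fin p) ℝ) = perturbedPrecision 0 0 := by
    simp [perturbedPrecision]
  rw [h]
  refine perturbedPrecision_mem hM (sq_nonneg _) isHermitian_zero (by simp) fun j => ?_
  rw [← h]
  refine le_trans (Finset.card_le_card (t := {j}) fun i hi => ?_) (by simpa using hk)
  by_contra hij
  simp_all [one_apply]

end

/-! ### From estimation to testing -/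

/-- A finite family of symmetric perturbations `D s` of the identity covariance matrix,
all with `D ^ 3 = t • D`, whose mixture of `n`-sample likelihood ratios has second moment at
most `K`. -/
structure PerturbationFamily (n p : ℕ) (M : ℝ) (k : ℕ) (K t : ℝ) (T : Type*) [Fintype T] where
  D : T → Matrix (Fin p) (Fin p) ℝ
  t_le : t ≤ (1 - 1 / M) ^ 2
  t_le' : t ≤ 1 / 4
  one_le : 1 ≤ K
  hermitian : ∀ s, (D s).IsHermitian
  cube : ∀ s, D s * D s * D s = t • D s
  sparse : ∀ s j, (Finset.univ.filter fun i => perturbedPrecision t (D s) i j ≠ 0).card ≤ k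
  moment : ∑ s, ∑ s', (Real.sqrt ((1 - D s * D s').det)⁻¹) ^ n ≤ (Fintype.card T : ℝ) ^ 2 * K

namespace PerturbationFamily

variable {n p k : ℕ} {M K t : ℝ} {T : Type*} [Fintype T]

theorem le_error [Nonempty T] (P : PerturbationFamily n p M k K t T)
    {A : Set (Fin n → EuclideanSpace ℝ (Fin p))} (hA : MeasurableSet A) {e : ℝ≥0∞}
    (h0 : sampleLaw n (1 : Matrix (Fin p) (Fin p) ℝ) A ≤ e)
    (h1 : ∀ s, sampleLaw n (perturbedPrecision t (P.D s)) Aᶜ ≤ e) :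
    ENNReal.ofReal (1 / (4 * K)) ≤ e := by
  have hpd := fun s => posDef_perturbedPrecision P.t_le' (P.hermitian s)
  refine le_error_of_mixture_second_moment
    (ℓ := fun s => sampleRatio n (perturbedPrecision t (P.D s)))
    (fun s => measurable_sampleRatio n _) (fun s => ?_) P.one_le ?_ hA h0 (fun s => ?_)
  · have h : sampleLaw n (perturbedPrecision t (P.D s)) Set.univ = 1 := measure_univ
    rwa [sampleLaw_eq_withDensity n (hpd s), withDensity_apply _ MeasurableSet.univ,
      Measure.restrict_univ] at h
  · refine le_trans (le_of_eq ?_) (ENNReal.ofReal_le_ofReal P.moment)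
    rw [ENNReal.ofReal_sum_of_nonneg
      fun s _ => Finset.sum_nonneg fun s' _ => pow_nonneg (Real.sqrt_nonneg _) _]
    refine Finset.sum_congr rfl fun s _ => ?_
    rw [ENNReal.ofReal_sum_of_nonneg fun s' _ => pow_nonneg (Real.sqrt_nonneg _) _]
    refine Finset.sum_congr rfl fun s' _ => ?_
    rw [lintegral_sampleRatio_mul n (hpd s) (hpd s') (posDef_perturbedPrecision_add_sub_one
      P.t_le' (P.hermitian s) (P.hermitian s')), det_perturbedPrecision_ratio P.t_le'
      (P.hermitian s) (P.hermitian s') (P.cube s) (P.cube s')]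
  · rw [← sampleLaw_eq_withDensity n (hpd s)]
    exact h1 s

theorem mem_class (P : PerturbationFamily n p M k K t T) (hM : 1 < M) (s : T) :
    perturbedPrecision t (P.D s) ∈ sparsePrecisionClass p M k :=
  perturbedPrecision_mem hM P.t_le (P.hermitian s) (P.cube s) (P.sparse s)

/-- The test rejects when the estimate is further than `r` from the null value. By the triangle
inequality, accepting forces an error above `r` under every alternative. -/
theorem le_entryMinimaxProb [Nonempty T] (P : PerturbationFamily n p M k K t T) (hM : 1 < M) (hk : 1 ≤ k)
    {i j : Fin p} {r : ℝ}
    (hr : ∀ s, 2 * r < |perturbedPrecision t (P.D s) i j - (1 : Matrix (Fin p) (Fin p) ℝ) i j|) :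
    ENNReal.ofReal (1 / (4 * K)) ≤ entryMinimaxProb n p M k i j r := by
  refine le_iInf fun f => ?_
  have hf := f.2
  refine P.le_error (A := {x | r < |f.1 x - (1 : Matrix (Fin p) (Fin p) ℝ) i j|})
    (measurableSet_lt measurable_const (by fun_prop)) ?_ fun s => ?_
  · exact le_iSup₂ (f := fun Ω (_ : Ω ∈ sparsePrecisionClass p M k) =>
      sampleLaw n Ω {x | r < |f.1 x - Ω i j|}) _ (one_mem_sparsePrecisionClass hM hk)
  · refine le_trans (measure_mono fun x hx => ?_)
      (le_iSup₂ (f := fun Ω (_ : Ω ∈ sparsePrecisionClass p M k) =>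
      sampleLaw n Ω {x | r < |f.1 x - Ω i j|}) _ (P.mem_class hM s))
    simp only [Set.mem_compl_iff, Set.mem_ofPred_eq, not_lt] at hx ⊢
    have h1 := abs_sub_le (perturbedPrecision t (P.D s) i j) (f.1 x)
      ((1 : Matrix (Fin p) (Fin p) ℝ) i j)
    have h2 := hr s
    rw [abs_sub_comm (perturbedPrecision t (P.D s) i j) (f.1 x)] at h1
    linarith

theorem le_matrixMinimaxProb [Nonempty T] (P : PerturbationFamily n p M k K t T) (hM : 1 < M) (hk : 1 ≤ k)
    {r : ℝ} (hr : ∀ s, ∃ i j, 2 * r <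
      |perturbedPrecision t (P.D s) i j - (1 : Matrix (Fin p) (Fin p) ℝ) i j|) :
    ENNReal.ofReal (1 / (4 * K)) ≤ matrixMinimaxProb n p M k r := by
  have hle : ∀ (B : Matrix (Fin p) (Fin p) ℝ) i j, |B i j| ≤ entryMaxNorm B := fun B i j =>
    le_ciSup (f := fun ab : Fin p × Fin p => |B ab.1 ab.2|) (Set.finite_range _).bddAbove (i, j)
  refine le_iInf fun F => ?_
  have hF := F.2
  -- A union over all entries is measurable entry by entry, and lets the separated entry depend on
  -- the alternative.
  refine P.le_error (A := ⋃ a, ⋃ b, {x | r < |F.1 x a b - (1 : Matrix (Fin p) (Fin p) ℝ) a b|})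
    ?_ ?_ fun s => ?_
  · exact MeasurableSet.iUnion fun a => MeasurableSet.iUnion fun b =>
      measurableSet_lt measurable_const ((hF a b).sub_const _).abs
  · refine le_trans (measure_mono fun x hx => ?_)
      (le_iSup₂ (f := fun Ω (_ : Ω ∈ sparsePrecisionClass p M k) =>
      sampleLaw n Ω {x | r < entryMaxNorm (F.1 x - Ω)}) _ (one_mem_sparsePrecisionClass hM hk))
    simp only [Set.mem_iUnion, Set.mem_ofPred_eq] at hx ⊢
    obtain ⟨a, b, hab⟩ := hx
    exact hab.trans_le (hle (F.1 x - 1) a b)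
  · refine le_trans (measure_mono fun x hx => ?_)
      (le_iSup₂ (f := fun Ω (_ : Ω ∈ sparsePrecisionClass p M k) =>
      sampleLaw n Ω {x | r < entryMaxNorm (F.1 x - Ω)}) _ (P.mem_class hM s))
    simp only [Set.mem_compl_iff, Set.mem_iUnion, Set.mem_ofPred_eq, not_exists, not_lt] at hx ⊢
    obtain ⟨i, j, h2⟩ := hr s
    refine lt_of_lt_of_le ?_ (hle (F.1 x - perturbedPrecision t (P.D s)) i j)
    have h1 := abs_sub_le (perturbedPrecision t (P.D s) i j) (F.1 x i j)
      ((1 : Matrix (Fin p) (Fin p) ℝ) i j)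
    have h3 := hx i j
    rw [abs_sub_comm (perturbedPrecision t (P.D s) i j) (F.1 x i j)] at h1
    rw [Matrix.sub_apply]
    linarith

end PerturbationFamily

/-! ### Rank-two perturbations -/

open Matrix in
theorem det_one_sub_vecMulVec {p : ℕ} (u v : Fin p → ℝ) :
    (1 - vecMulVec u v).det = 1 - u ⬝ᵥ v := by
  have h := det_one_add_replicateCol_mul_replicateRow (ι := Unit) (-u) v
  rw [← vecMulVec_eq, neg_vecMulVec, ← sub_eq_add_neg, dotProduct_neg, ← sub_eq_add_neg] at h
  rw [h, dotProduct_comm]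

section

open Matrix

variable {p : ℕ} {a : ℝ} {u w w₁ w₂ : Fin p → ℝ}

/-- The symmetric matrix `a (u wᵀ + w uᵀ)`. -/
def crossPerturbation (a : ℝ) (u w : Fin p → ℝ) : Matrix (Fin p) (Fin p) ℝ :=
  a • (vecMulVec u w + vecMulVec w u)

theorem isHermitian_crossPerturbation : (crossPerturbation a u w).IsHermitian := by
  rw [IsHermitian, conjTranspose_eq_transpose_of_trivial, crossPerturbation, transpose_smul,
    transpose_add, transpose_vecMulVec, transpose_vecMulVec, add_comm]

theorem crossPerturbation_mul (h₁ : u ⬝ᵥ w₁ = 0) (h₂ : u ⬝ᵥ w₂ = 0) :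
    crossPerturbation a u w₁ * crossPerturbation a u w₂ =
      a ^ 2 • ((w₁ ⬝ᵥ w₂) • vecMulVec u u + (u ⬝ᵥ u) • vecMulVec w₁ w₂) := by
  rw [crossPerturbation, crossPerturbation, smul_mul_smul_comm, add_mul, mul_add, mul_add]
  simp only [vecMulVec_mul_vecMulVec, h₂, dotProduct_comm w₁ u, h₁, zero_smul, vecMulVec_zero,
    vecMulVec_smul, zero_add, add_zero, sq]

theorem crossPerturbation_cube (h : u ⬝ᵥ w = 0) :
    crossPerturbation a u w * crossPerturbation a u w * crossPerturbation a u w =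
      (a ^ 2 * (u ⬝ᵥ u) * (w ⬝ᵥ w)) • crossPerturbation a u w := by
  rw [crossPerturbation_mul h h]
  simp only [crossPerturbation, smul_mul_assoc, mul_smul_comm, add_mul, mul_add,
    vecMulVec_mul_vecMulVec, h, dotProduct_comm w u, zero_smul, vecMulVec_zero,
    vecMulVec_smul, smul_zero, zero_add, add_zero, smul_add, smul_smul]
  ring_nf

/-- Since `w₂ ⊥ u`, the matrix factors into two rank-one updates of the identity with equal
determinants. The resulting square cancels the square root in the Gaussian normalisation. -/
theorem det_one_sub_crossPerturbation_mul (h₁ : u ⬝ᵥ w₁ = 0) (h₂ : u ⬝ᵥ w₂ = 0) :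
    (1 - crossPerturbation a u w₁ * crossPerturbation a u w₂).det =
      (1 - a ^ 2 * (u ⬝ᵥ u) * (w₁ ⬝ᵥ w₂)) ^ 2 := by
  have h : 1 - crossPerturbation a u w₁ * crossPerturbation a u w₂ =
      (1 - vecMulVec ((a ^ 2 * (u ⬝ᵥ u)) • w₁) w₂) *
        (1 - vecMulVec ((a ^ 2 * (w₁ ⬝ᵥ w₂)) • u) u) := by
    rw [crossPerturbation_mul h₁ h₂, sub_mul, mul_sub, mul_sub, vecMulVec_mul_vecMulVec]
    simp only [one_mul, mul_one, dotProduct_smul, dotProduct_comm w₂ u, h₂, smul_zero, zero_smul,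
      vecMulVec_zero, sub_zero, smul_vecMulVec, smul_add, smul_smul]
    abel
  rw [h, det_mul, det_one_sub_vecMulVec, det_one_sub_vecMulVec, smul_dotProduct, smul_dotProduct,
    smul_eq_mul, smul_eq_mul]
  ring

theorem perturbedPrecision_crossPerturbation_apply (t : ℝ) (h : u ⬝ᵥ w = 0) (i j : Fin p) :
    perturbedPrecision t (crossPerturbation a u w) i j = (1 : Matrix (Fin p) (Fin p) ℝ) i j -
      (1 - t)⁻¹ * (a * (u i * w j + w i * u j) -
        a ^ 2 * ((w ⬝ᵥ w) * (u i * u j) + (u ⬝ᵥ u) * (w i * w j))) := by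
  rw [perturbedPrecision, crossPerturbation_mul h h]
  simp only [crossPerturbation, vecMulVec_apply, Matrix.sub_apply, Matrix.add_apply,
    Matrix.smul_apply, smul_eq_mul]

/-- The indicator vector of a finite set of coordinates. -/
def indicatorVec (S : Finset (Fin p)) : Fin p → ℝ := fun i => if i ∈ S then 1 else 0

theorem indicatorVec_dotProduct (S H : Finset (Fin p)) :
    indicatorVec S ⬝ᵥ indicatorVec H = ((S ∩ H).card : ℝ) := by
  simp [indicatorVec, dotProduct, Finset.inter_comm]

/-- The matrix differs from the identity only on the square block indexed by `S ∪ H`; any other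
column has only its diagonal entry. -/
theorem card_support_perturbedPrecision_cross {k : ℕ} (t : ℝ) {S H : Finset (Fin p)}
    (hd : Disjoint S H) (hk : S.card + H.card ≤ k) (hS : S.Nonempty) (j : Fin p) :
    (Finset.univ.filter fun i => perturbedPrecision t
      (crossPerturbation a (indicatorVec S) (indicatorVec H)) i j ≠ 0).card ≤ k := by
  have h0 : indicatorVec S ⬝ᵥ indicatorVec H = 0 := by
    rw [indicatorVec_dotProduct, Finset.disjoint_iff_inter_eq_empty.1 hd]; simp
  by_cases hj : j ∈ S ∪ H
  · refine le_trans (Finset.card_le_card (t := S ∪ H) fun i hi => ?_)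
      ((Finset.card_union_le _ _).trans hk)
    by_contra hij
    have hne : i ≠ j := fun h => hij (h ▸ hj)
    rw [Finset.mem_union, not_or] at hij
    simp [perturbedPrecision_crossPerturbation_apply t h0, indicatorVec, hij.1, hij.2,
      one_apply_ne hne] at hi
  · refine le_trans (Finset.card_le_card (t := {j}) fun i hi => ?_)
      (le_trans ?_ hk)
    · by_contra hne
      rw [Finset.mem_singleton] at hne
      rw [Finset.mem_union, not_or] at hj
      simp [perturbedPrecision_crossPerturbation_apply t h0, indicatorVec, hj.1, hj.2,
        one_apply_ne hne] at hi
    · have := hS.card_pos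
      simp only [Finset.card_singleton]
      omega

end

/-! ### Families of alternatives and their second moments -/

/-- The sum of `U ^ #{l | f l = g l}` over pairs of functions. -/
theorem sum_sum_pow_card_agree {m B : ℕ} (U : ℝ) :
    ∑ f : Fin m → Fin B, ∑ g : Fin m → Fin B,
      U ^ (Finset.univ.filter fun l => f l = g l).card = ((B : ℝ) * (U + (B - 1))) ^ m := by
  have h : ∀ f : Fin m → Fin B, ∑ g : Fin m → Fin B,
      U ^ (Finset.univ.filter fun l => f l = g l).card = (U + (B - 1)) ^ m := fun f => by
    have h1 : ∀ g : Fin m → Fin B, U ^ (Finset.univ.filter fun l => f l = g l).card =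
        ∏ l, if f l = g l then U else 1 := fun g => by
      rw [Finset.prod_ite]; simp
    simp_rw [h1]
    -- Distributivity: the blocks are chosen independently, so the sum over `g` factors over `l`.
    have h2 := Finset.prod_univ_sum (fun _ : Fin m => (Finset.univ : Finset (Fin B)))
      (fun l b => if f l = b then U else (1 : ℝ))
    rw [Fintype.piFinset_univ] at h2
    rw [← h2]
    have h3 : ∀ l, ∑ b : Fin B, (if f l = b then U else (1 : ℝ)) = U + (B - 1) := fun l => by
      have : ∀ b : Fin B, (if f l = b then U else (1 : ℝ)) = (if f l = b then U - 1 else 0) + 1 :=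
        fun b => by split_ifs <;> ring
      simp_rw [this, Finset.sum_add_distrib]
      simp
      ring
    simp [h3]
  simp_rw [h]
  simp [mul_pow]

theorem inv_one_sub_le_exp {x : ℝ} (hx0 : 0 ≤ x) (hx : x ≤ 1 / 4) :
    (1 - x)⁻¹ ≤ Real.exp (2 * x) := by
  refine le_trans ?_ (Real.add_one_le_exp _)
  rw [inv_le_iff_one_le_mul₀ (by linarith)]
  nlinarith

theorem card_image_block {p m B : ℕ} (emb : Fin m × Fin B ↪ Fin p) (f g : Fin m → Fin B) :
    (Finset.univ.image (fun l => emb (l, f l)) ∩ Finset.univ.image fun l => emb (l, g l)).card =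
      (Finset.univ.filter fun l => f l = g l).card := by
  rw [← Finset.card_image_of_injective (Finset.univ.filter fun l => f l = g l)
    (f := fun l => emb (l, f l)) fun l l' h => (Prod.ext_iff.1 (emb.injective h)).1]
  congr 1
  ext i
  simp only [Finset.mem_inter, Finset.mem_image, Finset.mem_univ, true_and, Finset.mem_filter]
  constructor
  · rintro ⟨⟨l, rfl⟩, l', h⟩
    have h' := Prod.ext_iff.1 (emb.injective h)
    simp only at h'
    obtain ⟨rfl, h2⟩ := h'
    exact ⟨l', h2.symm, rfl⟩
  · rintro ⟨l, h, rfl⟩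
    exact ⟨⟨l, rfl⟩, l, by rw [h]⟩

theorem indicatorVec_dotProduct_image_block {p m B : ℕ} {S : Finset (Fin p)}
    {emb : Fin m × Fin B ↪ Fin p} (hemb : ∀ x, emb x ∉ S) (f : Fin m → Fin B) :
    indicatorVec S ⬝ᵥ indicatorVec (Finset.univ.image fun l => emb (l, f l)) = 0 := by
  have : S ∩ (Finset.univ.image fun l => emb (l, f l)) = ∅ := by
    ext i; simp only [Finset.mem_inter, Finset.mem_image, Finset.notMem_empty, iff_false]
    rintro ⟨h, l, -, rfl⟩; exact hemb _ h
  rw [indicatorVec_dotProduct, this]; simp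

/-- Perturbations `a (u wᵀ + w uᵀ)`, where `u` is the indicator of `S` and `w` that of a set which
has exactly one element in each of `m` disjoint blocks of size `B`. -/
def blockFamily {n p k m B : ℕ} {M κ a t : ℝ} (S : Finset (Fin p)) (hS : S.Nonempty)
    (emb : Fin m × Fin B ↪ Fin p) (hemb : ∀ x, emb x ∉ S) (hB : 0 < B) (hk : S.card + m ≤ k)
    (ht : t = a ^ 2 * S.card * m) (ht1 : t ≤ (1 - 1 / M) ^ 2) (ht2 : t ≤ 1 / 4)
    (hκ : m * Real.exp (2 * n * a ^ 2 * S.card) ≤ κ * B) :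
    PerturbationFamily n p M k (Real.exp κ) t (Fin m → Fin B) where
  D f := crossPerturbation a (indicatorVec S)
    (indicatorVec (Finset.univ.image fun l => emb (l, f l)))
  t_le := ht1
  t_le' := ht2
  one_le := by
    refine Real.one_le_exp ?_
    have h1 : 0 ≤ κ * B := le_trans (by positivity) hκ
    exact nonneg_of_mul_nonneg_left h1 (by exact_mod_cast hB)
  hermitian f := isHermitian_crossPerturbation
  cube f := by
    rw [crossPerturbation_cube (indicatorVec_dotProduct_image_block hemb f),
      indicatorVec_dotProduct, indicatorVec_dotProduct, card_image_block, ht]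
    simp
  sparse f j := by
    refine card_support_perturbedPrecision_cross t ?_ ?_ hS j
    · rw [Finset.disjoint_right]
      rintro i hi
      obtain ⟨l, -, rfl⟩ := Finset.mem_image.1 hi
      exact hemb _
    · refine le_trans (Nat.add_le_add_left (Finset.card_image_le) _) (by simpa using hk)
  moment := by
    have hd := indicatorVec_dotProduct_image_block hemb
    have hB' : (0 : ℝ) < B := by exact_mod_cast hB
    set U := Real.exp (2 * n * a ^ 2 * S.card) with hU
    have hterm : ∀ f g : Fin m → Fin B,
        (Real.sqrt ((1 - crossPerturbation a (indicatorVec S)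
            (indicatorVec (Finset.univ.image fun l => emb (l, f l))) *
          crossPerturbation a (indicatorVec S)
            (indicatorVec (Finset.univ.image fun l => emb (l, g l)))).det)⁻¹) ^ n ≤
        U ^ (Finset.univ.filter fun l => f l = g l).card := fun f g => by
      rw [det_one_sub_crossPerturbation_mul (hd f) (hd g), indicatorVec_dotProduct,
        indicatorVec_dotProduct, card_image_block, Finset.inter_self]
      set r := (Finset.univ.filter fun l => f l = g l).card with hr
      have hrm : (r : ℝ) ≤ m := by
        have : r ≤ m := by simpa using Finset.card_filter_le Finset.univ fun l => f l = g l
        exact_mod_cast this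
      have hx0 : 0 ≤ a ^ 2 * S.card * r := by positivity
      have hx : a ^ 2 * S.card * r ≤ 1 / 4 :=
        le_trans (by rw [ht]; gcongr) ht2
      rw [← inv_pow, Real.sqrt_sq (inv_nonneg.2 (by linarith))]
      refine le_trans (pow_le_pow_left₀ (inv_nonneg.2 (by linarith))
        (inv_one_sub_le_exp hx0 hx) n) (le_of_eq ?_)
      rw [hU, ← Real.exp_nat_mul, ← Real.exp_nat_mul]
      ring_nf
    refine le_trans (Finset.sum_le_sum fun f _ => Finset.sum_le_sum fun g _ => hterm f g) ?_
    rw [sum_sum_pow_card_agree]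
    -- Per block, `1 + (U - 1) / B ≤ exp (U / B)`; the `m`-th power is then controlled by `m U ≤ κ
    -- B`.
    have h1 : (B : ℝ) * (U + (B - 1)) ≤ B ^ 2 * Real.exp (U / B) := by
      have h2 := Real.add_one_le_exp (U / B)
      have h3 : (B : ℝ) * (U + (B - 1)) ≤ B ^ 2 * (U / B + 1) := by
        have : (B : ℝ) ^ 2 * (U / B + 1) = B * (U + B) := by field_simp
        rw [this]
        nlinarith
      exact h3.trans (by gcongr)
    have hB1 : (1 : ℝ) ≤ B := by exact_mod_cast hB
    have hU0 : 0 < U := Real.exp_pos _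
    refine le_trans (pow_le_pow_left₀ (mul_nonneg hB'.le (by linarith)) h1 m) ?_
    rw [mul_pow, ← Real.exp_nat_mul, ← pow_mul, mul_comm 2 m, pow_mul]
    simp only [Fintype.card_fun, Fintype.card_fin, Nat.cast_pow]
    gcongr
    rw [← mul_div_assoc, div_le_iff₀ hB']
    exact hκ

/-- The perturbation of a single diagonal entry. -/
noncomputable def diagonalFamily {n p k : ℕ} {M a : ℝ} (i : Fin p) (hk : 1 ≤ k)
    (ht1 : a ^ 2 ≤ (1 - 1 / M) ^ 2) (ht2 : a ^ 2 ≤ 1 / 4) :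
    PerturbationFamily n p M k (Real.exp (2 * n * a ^ 2)) (a ^ 2) Unit where
  D _ := a • Matrix.vecMulVec (Pi.single i 1) (Pi.single i 1)
  t_le := ht1
  t_le' := ht2
  one_le := Real.one_le_exp (by positivity)
  hermitian _ := by
    rw [Matrix.IsHermitian, Matrix.conjTranspose_eq_transpose_of_trivial, Matrix.transpose_smul,
      Matrix.transpose_vecMulVec]
  cube _ := by
    simp only [smul_mul_assoc, mul_smul_comm, Matrix.vecMulVec_mul_vecMulVec]
    simp only [single_dotProduct, Pi.single_eq_same, mul_one, one_smul, smul_smul]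
    ring_nf
  sparse _ j := by
    refine le_trans (Finset.card_le_card (t := {j}) fun l hl => ?_) (by simpa using hk)
    by_contra hne
    rw [Finset.mem_singleton] at hne
    have h0 : (Pi.single i 1 : Fin p → ℝ) l * (Pi.single i 1 : Fin p → ℝ) j = 0 := by
      by_cases h : l = i
      · have : j ≠ i := fun h' => hne (h.trans h'.symm)
        simp [this]
      · simp [h]
    simp [perturbedPrecision, Matrix.one_apply_ne hne, Matrix.vecMulVec_mul_vecMulVec,
      Matrix.vecMulVec_apply, h0] at hl
  moment := by
    have hx0 : 0 ≤ a ^ 2 := sq_nonneg a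
    have h : (1 - a • Matrix.vecMulVec (Pi.single i 1 : Fin p → ℝ) (Pi.single i 1) *
        a • Matrix.vecMulVec (Pi.single i 1 : Fin p → ℝ) (Pi.single i 1)).det = 1 - a ^ 2 := by
      rw [smul_mul_smul_comm, Matrix.vecMulVec_mul_vecMulVec]
      simp only [single_dotProduct, Pi.single_eq_same, mul_one, one_smul]
      rw [← Matrix.smul_vecMulVec, det_one_sub_vecMulVec]
      simp [sq]
    simp only [Finset.univ_unique, Finset.sum_singleton, h, Fintype.card_unit, Nat.cast_one,
      one_pow, one_mul]
    have h1 : (1 : ℝ) ≤ (1 - a ^ 2)⁻¹ := (one_le_inv₀ (by linarith)).2 (by linarith)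
    have h2 : Real.sqrt (1 - a ^ 2)⁻¹ ≤ Real.exp (2 * a ^ 2) :=
      (Real.sqrt_le_iff.2 ⟨by linarith, by nlinarith⟩).trans (inv_one_sub_le_exp hx0 ht2)
    refine (pow_le_pow_left₀ (Real.sqrt_nonneg _) h2 n).trans (le_of_eq ?_)
    rw [← Real.exp_nat_mul]
    ring_nf

theorem exists_embedding_avoiding {p m B : ℕ} (S : Finset (Fin p)) (h : m * B + S.card ≤ p) :
    ∃ emb : Fin m × Fin B ↪ Fin p, ∀ x, emb x ∉ S := by
  have hc : Fintype.card (Fin m × Fin B) ≤ Fintype.card {x // x ∈ Sᶜ} := by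
    rw [Fintype.card_prod, Fintype.card_fin, Fintype.card_fin, Fintype.card_coe,
      Finset.card_compl, Fintype.card_fin]
    omega
  obtain ⟨e⟩ := Function.Embedding.nonempty_of_card_le hc
  exact ⟨e.trans (Function.Embedding.subtype _), fun x => by
    simpa using Finset.mem_compl.1 (e x).2⟩

theorem sq_le_of_rpow_le {p k : ℕ} {ν : ℝ} (hν : 2 < ν) (hk : 1 ≤ k) (hp : (k : ℝ) ^ ν ≤ p) :
    k ^ 2 ≤ p := by
  have h : (k : ℝ) ^ (2 : ℝ) ≤ p :=
    (Real.rpow_le_rpow_of_exponent_le (by exact_mod_cast hk) hν.le).trans hp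
  rw [Real.rpow_two] at h
  exact_mod_cast h

/-- The block size `(p - 2) / m` is large enough for the second moment of the mixture to be
bounded. -/
theorem block_size_bound {p k m : ℕ} {ν τ y : ℝ} (hν : 2 < ν) (hk : 3 ≤ k)
    (hp : (k : ℝ) ^ ν ≤ p) (hτ : τ ≤ (1 - 2 / ν) / 4) (hm : 1 ≤ m) (hmk : m + 2 ≤ k)
    (hy : y ≤ 4 * τ * Real.log p) :
    0 < (p - 2) / m ∧ m * ((p - 2) / m) + 2 ≤ p ∧
      m * Real.exp y ≤ 4 * (((p - 2) / m : ℕ) : ℝ) := by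
  have hkp := sq_le_of_rpow_le hν (by omega) hp
  have h9 : 9 ≤ p := le_trans (by nlinarith) hkp
  have hmp : m ≤ p - 2 := by
    have : k * 3 ≤ p := le_trans (by nlinarith) hkp
    omega
  have hB : 0 < (p - 2) / m := Nat.div_pos hmp hm
  have hmB : m * ((p - 2) / m) ≤ p - 2 := Nat.mul_div_le _ _
  refine ⟨hB, by omega, ?_⟩
  set B := (p - 2) / m with hBdef
  have h1 : p - 2 < m * (B + 1) := by
    rw [hBdef, mul_add, mul_one]
    have := Nat.div_add_mod (p - 2) m
    have := Nat.mod_lt (p - 2) hm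
    omega
  -- Rounding in `(p - 2) / m` costs at most this factor `4`, which becomes the `κ = 4` of the
  -- families.
  have h2 : p ≤ 4 * (m * B) := by
    have : m * 1 ≤ m * B := Nat.mul_le_mul_left m hB
    rw [mul_add] at h1
    omega
  have h2' : (p : ℝ) ≤ m * (4 * B) := by
    have : (p : ℝ) ≤ 4 * (m * B) := by exact_mod_cast h2
    linarith
  have hp0 : (0 : ℝ) < p := by exact_mod_cast (by omega : 0 < p)
  have hm0 : (0 : ℝ) < m := by exact_mod_cast hm
  have hlog : 0 ≤ Real.log p := Real.log_natCast_nonneg p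
  have h3 : Real.exp y ≤ (p : ℝ) ^ (1 - 2 / ν) := by
    rw [Real.rpow_def_of_pos hp0]
    refine Real.exp_le_exp.2 (hy.trans ?_)
    rw [mul_comm]
    exact mul_le_mul_of_nonneg_left (by linarith) hlog
  have h4 : (m : ℝ) ^ 2 ≤ (p : ℝ) ^ (2 / ν) := by
    have hk0 : (0 : ℝ) ≤ k := Nat.cast_nonneg k
    have h5 : ((k : ℝ) ^ ν) ^ (2 / ν) = (k : ℝ) ^ 2 := by
      rw [← Real.rpow_mul hk0, mul_div_cancel₀ _ (by linarith), Real.rpow_two]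
    have h6 : (m : ℝ) ≤ k := by exact_mod_cast (by omega : m ≤ k)
    calc (m : ℝ) ^ 2 ≤ (k : ℝ) ^ 2 := by gcongr
      _ = ((k : ℝ) ^ ν) ^ (2 / ν) := h5.symm
      _ ≤ (p : ℝ) ^ (2 / ν) :=
        Real.rpow_le_rpow (Real.rpow_nonneg hk0 _) hp (by positivity)
  have h7 : (m : ℝ) ^ 2 * Real.exp y ≤ p := by
    calc (m : ℝ) ^ 2 * Real.exp y ≤ (p : ℝ) ^ (2 / ν) * (p : ℝ) ^ (1 - 2 / ν) := by gcongr
      _ = p := by rw [← Real.rpow_add hp0]; simp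
  refine le_of_mul_le_mul_left ?_ hm0
  rw [← mul_assoc, ← sq]
  exact h7.trans h2'

/-! ### Size of the perturbed entries -/

section

open Matrix

variable {p : ℕ} {a t : ℝ} {S H : Finset (Fin p)} {i j : Fin p}

/-- On `S × S` the first-order term vanishes, because the indicator of `H` does; only `D²`
contributes. -/
theorem le_abs_perturbedPrecision_sub_one_of_mem (ht0 : 0 ≤ t) (ht : t ≤ 1 / 4)
    (h : indicatorVec S ⬝ᵥ indicatorVec H = 0) (hi : i ∈ S) (hj : j ∈ S)
    (hi' : i ∉ H) (hj' : j ∉ H) :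
    a ^ 2 * H.card ≤ |perturbedPrecision t (crossPerturbation a (indicatorVec S)
      (indicatorVec H)) i j - (1 : Matrix (Fin p) (Fin p) ℝ) i j| := by
  rw [perturbedPrecision_crossPerturbation_apply t h, indicatorVec_dotProduct H H]
  simp only [indicatorVec, hi, hj, hi', hj', if_true, if_false, Finset.inter_self]
  refine le_trans ?_ (le_abs_self _)
  have h1 : (1 : ℝ) ≤ (1 - t)⁻¹ := (one_le_inv₀ (by linarith)).2 (by linarith)
  have h2 : 0 ≤ a ^ 2 * (H.card : ℝ) := by positivity
  nlinarith

/-- On `S × H` the roles reverse: `D²` vanishes and the first-order term `a` remains. -/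
theorem le_abs_perturbedPrecision_sub_one_of_cross (ht0 : 0 ≤ t) (ht : t ≤ 1 / 4)
    (h : indicatorVec S ⬝ᵥ indicatorVec H = 0) (ha : 0 ≤ a) (hi : i ∈ S) (hj : j ∉ S)
    (hi' : i ∉ H) (hj' : j ∈ H) :
    a ≤ |perturbedPrecision t (crossPerturbation a (indicatorVec S)
      (indicatorVec H)) i j - (1 : Matrix (Fin p) (Fin p) ℝ) i j| := by
  rw [perturbedPrecision_crossPerturbation_apply t h]
  simp only [indicatorVec, hi, hj, hi', hj', if_true, if_false]
  refine le_trans ?_ (neg_le_abs _)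
  have h1 : (1 : ℝ) ≤ (1 - t)⁻¹ := (one_le_inv₀ (by linarith)).2 (by linarith)
  nlinarith

end

/-! ### The three rates and the conclusion -/

section

variable {n p k : ℕ} {M ν C₀ δ τ : ℝ}

/-- Both minimax probabilities are bounded below at the scale `k log p / n`. -/
theorem le_minimaxProb_logRate (hM : 1 < M) (hν : 2 < ν) (hδ : δ ≤ (1 - 1 / M) ^ 2)
    (hδ' : δ ≤ 1 / 4) (hτ0 : 0 < τ) (hτ : τ ≤ (1 - 2 / ν) / 4) (hτ' : 2 * τ * C₀ ≤ δ)
    (hn : 0 < n) (hp : (k : ℝ) ^ ν ≤ p) (hk : 3 ≤ k) (hkn : k * Real.log p ≤ C₀ * n)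
    (i j : Fin p) :
    ENNReal.ofReal (1 / (4 * Real.exp 4)) ≤
        entryMinimaxProb n p M k i j (τ / 7 * (k * Real.log p / n)) ∧
      ENNReal.ofReal (1 / (4 * Real.exp 4)) ≤
        matrixMinimaxProb n p M k (τ / 7 * (k * Real.log p / n)) := by
  have hp9 : 9 ≤ p := le_trans (by nlinarith) (sq_le_of_rpow_le hν (by omega) hp)
  have hlog : 0 < Real.log p := Real.log_pos (by exact_mod_cast (by omega : 1 < p))
  have hn0 : (0 : ℝ) < n := by exact_mod_cast hn
  -- Two of the `k` allowed nonzeros per column are reserved for `S = {i, j}`, which is a singleton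
  -- when `i = j`.
  obtain ⟨m, rfl⟩ : ∃ m, k = m + 2 := ⟨k - 2, by omega⟩
  have hm1 : (1 : ℝ) ≤ m := by exact_mod_cast (by omega : 1 ≤ m)
  set a := Real.sqrt (τ * Real.log p / n) with ha
  have ha2 : a ^ 2 = τ * Real.log p / n := Real.sq_sqrt (by positivity)
  set S : Finset (Fin p) := {i, j} with hS
  have hScard : S.card ≤ 2 := Finset.card_le_two
  have hScard' : (S.card : ℝ) ≤ 2 := by exact_mod_cast hScard
  have hi : i ∈ S := by simp [hS]
  have hj : j ∈ S := by simp [hS]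
  obtain ⟨hB, hmB, hκ⟩ := block_size_bound (m := m) (y := 2 * n * a ^ 2 * S.card) hν hk hp hτ
    (by omega) le_rfl (by
      have h1 : 2 * n * a ^ 2 * S.card = 2 * (τ * Real.log p) * S.card := by
        rw [ha2]; field_simp
      have h2 : 0 < τ * Real.log p := by positivity
      rw [h1]; nlinarith)
  obtain ⟨emb, hemb⟩ := exists_embedding_avoiding (m := m) (B := (p - 2) / m) S (by omega)
  have ht : a ^ 2 * S.card * m ≤ δ := by
    have h1 : (m : ℝ) * Real.log p / n ≤ C₀ := by
      rw [div_le_iff₀ hn0]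
      push_cast at hkn
      nlinarith
    calc a ^ 2 * S.card * m ≤ a ^ 2 * 2 * m := by gcongr
      _ = 2 * τ * (m * Real.log p / n) := by rw [ha2]; ring
      _ ≤ 2 * τ * C₀ := by gcongr
      _ ≤ δ := hτ'
  have : Nonempty (Fin ((p - 2) / m)) := ⟨⟨0, hB⟩⟩
  let P : PerturbationFamily n p M (m + 2) (Real.exp 4) (a ^ 2 * S.card * m) _ :=
    blockFamily S ⟨i, hi⟩ emb hemb hB (by omega) rfl (ht.trans hδ) (ht.trans hδ') hκ
  have hsep : ∀ f, 2 * (τ / 7 * (((m + 2 : ℕ) : ℝ) * Real.log p / n)) <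
      |perturbedPrecision (a ^ 2 * S.card * m) (P.D f) i j -
        (1 : Matrix (Fin p) (Fin p) ℝ) i j| := fun f => by
    have hnot : ∀ x ∈ S, x ∉ Finset.univ.image fun l => emb (l, f l) := fun x hx hx' => by
      obtain ⟨l, -, rfl⟩ := Finset.mem_image.1 hx'
      exact hemb _ hx
    refine lt_of_lt_of_le ?_ (le_abs_perturbedPrecision_sub_one_of_mem (by positivity)
      (ht.trans hδ') (indicatorVec_dotProduct_image_block hemb f) hi hj (hnot i hi) (hnot j hj))
    have hc : (Finset.univ.image fun l => emb (l, f l)).card = m := by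
      have := card_image_block emb f f
      simpa using this
    rw [hc, ha2]
    have h1 : 0 < τ * Real.log p / n := by positivity
    have h2 : 2 * (τ / 7 * (((m + 2 : ℕ) : ℝ) * Real.log p / n)) =
      τ * Real.log p / n * (2 / 7 * (m + 2)) := by push_cast; ring
    rw [h2]
    -- The constant `τ / 7` comes from `2 (m + 2) / 7 < m`, tightest at `m = 1`.
    exact mul_lt_mul_of_pos_left (by linarith) h1
  exact ⟨P.le_entryMinimaxProb hM (by omega) hsep,
    P.le_matrixMinimaxProb hM (by omega) fun f => ⟨i, j, hsep f⟩⟩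

/-- The minimax probability for a single entry is bounded below at the scale `n ^ (-1/2)`. -/
theorem le_entryMinimaxProb_parametricRate (hM : 1 < M) (hτ0 : 0 < τ)
    (hτ : τ ≤ (1 - 1 / M) ^ 2) (hτ' : τ ≤ 1 / 4) (hn : 0 < n) (hk : 2 ≤ k) (i j : Fin p) :
    ENNReal.ofReal (1 / (4 * Real.exp 4)) ≤
      entryMinimaxProb n p M k i j (Real.sqrt τ / 4 * Real.sqrt (1 / n)) := by
  have hn0 : (0 : ℝ) < n := by exact_mod_cast hn
  have hn1 : (1 : ℝ) ≤ n := by exact_mod_cast hn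
  set a := Real.sqrt τ * Real.sqrt (1 / n) with ha
  have ha0 : 0 < a := by positivity
  have ha2 : a ^ 2 = τ / n := by
    rw [ha, mul_pow, Real.sq_sqrt hτ0.le, Real.sq_sqrt (by positivity)]; ring
  have haτ : a ^ 2 ≤ τ := by rw [ha2]; exact div_le_self hτ0.le hn1
  have hna : 2 * n * a ^ 2 = 2 * τ := by rw [ha2]; field_simp
  have hr : Real.sqrt τ / 4 * Real.sqrt (1 / n) = a / 4 := by rw [ha]; ring
  rw [hr]
  by_cases hij : i = j
  · subst hij
    refine le_trans (ENNReal.ofReal_le_ofReal ?_)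
      ((diagonalFamily (n := n) i (by omega) (haτ.trans hτ) (haτ.trans hτ')).le_entryMinimaxProb
        hM (by omega) fun _ => ?_)
    · gcongr
      rw [hna]; linarith
    · have ha1 : a ≤ 1 / 2 := by nlinarith
      have h1 : perturbedPrecision (a ^ 2)
          (a • Matrix.vecMulVec (Pi.single i 1 : Fin p → ℝ) (Pi.single i 1)) i i -
          (1 : Matrix (Fin p) (Fin p) ℝ) i i = -(a / (1 + a)) := by
        have h2 : 1 - a ^ 2 ≠ 0 := by nlinarith
        have h3 : 1 + a ≠ 0 := by linarith
        simp [perturbedPrecision, Matrix.vecMulVec_mul_vecMulVec, Matrix.vecMulVec_apply]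
        field_simp
        ring
      change 2 * (a / 4) < |perturbedPrecision (a ^ 2)
          (a • Matrix.vecMulVec (Pi.single i 1 : Fin p → ℝ) (Pi.single i 1)) i i -
          (1 : Matrix (Fin p) (Fin p) ℝ) i i|
      rw [h1, abs_neg, abs_of_pos (by positivity), lt_div_iff₀ (by positivity)]
      nlinarith
  -- One block of size one is a single alternative, perturbing exactly the pair `(i, j)`.
  · obtain ⟨emb, hj⟩ : ∃ emb : Fin 1 × Fin 1 ↪ Fin p, ∀ x, emb x = j :=
      ⟨⟨fun _ => j, fun x y _ => Subsingleton.elim x y⟩, fun _ => rfl⟩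
    have hemb : ∀ x, emb x ∉ ({i} : Finset (Fin p)) := fun x => by
      simpa [hj] using Ne.symm hij
    let P : PerturbationFamily n p M k (Real.exp 4) (a ^ 2) (Fin 1 → Fin 1) :=
      blockFamily (a := a) {i} (Finset.singleton_nonempty i) emb hemb one_pos (by simpa using hk)
        (by simp) (haτ.trans hτ) (haτ.trans hτ') (by
          have h1 : Real.exp (2 * τ) ≤ Real.exp 1 := Real.exp_le_exp.2 (by linarith)
          have h2 := Real.exp_one_lt_d9
          simp only [Finset.card_singleton, Nat.cast_one, mul_one, one_mul, hna]
          linarith)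
    refine P.le_entryMinimaxProb hM (by omega) fun f => ?_
    refine lt_of_lt_of_le (by linarith : 2 * (a / 4) < a)
      (le_abs_perturbedPrecision_sub_one_of_cross (sq_nonneg a) (haτ.trans hτ')
        (indicatorVec_dotProduct_image_block hemb f) ha0.le (by simp)
        (by simpa using Ne.symm hij) ?_ ?_)
    · simpa [hj] using hij
    · simp [hj]

/-- The minimax probability for the whole matrix is bounded below at the scale
`(log p / n) ^ (1/2)`. -/
theorem le_matrixMinimaxProb_sqrtLogRate (hM : 1 < M) (hν : 2 < ν) (hδ : δ ≤ (1 - 1 / M) ^ 2)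
    (hδ' : δ ≤ 1 / 4) (hτ0 : 0 < τ) (hτ : τ ≤ (1 - 2 / ν) / 4) (hτ' : 2 * τ * C₀ ≤ δ)
    (hn : 0 < n) (hp : (k : ℝ) ^ ν ≤ p) (hk : 3 ≤ k) (hkn : k * Real.log p ≤ C₀ * n) :
    ENNReal.ofReal (1 / (4 * Real.exp 4)) ≤
      matrixMinimaxProb n p M k (Real.sqrt τ / 4 * Real.sqrt (Real.log p / n)) := by
  have hp9 : 9 ≤ p := le_trans (by nlinarith) (sq_le_of_rpow_le hν (by omega) hp)
  have hlog : 0 < Real.log p := Real.log_pos (by exact_mod_cast (by omega : 1 < p))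
  have hn0 : (0 : ℝ) < n := by exact_mod_cast hn
  have hk3 : (3 : ℝ) ≤ k := by exact_mod_cast hk
  set a := Real.sqrt τ * Real.sqrt (Real.log p / n) with ha
  have ha0 : 0 < a := by positivity
  have ha2 : a ^ 2 = τ * Real.log p / n := by
    rw [ha, mul_pow, Real.sq_sqrt hτ0.le, Real.sq_sqrt (by positivity)]; ring
  have hr : Real.sqrt τ / 4 * Real.sqrt (Real.log p / n) = a / 4 := by rw [ha]; ring
  rw [hr]
  let i : Fin p := ⟨0, by omega⟩
  obtain ⟨hB, hmB, hκ⟩ := block_size_bound (m := 1) (y := 2 * n * a ^ 2) hν hk hp hτ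
    le_rfl (by omega) (by
      have h1 : 2 * n * a ^ 2 = 2 * (τ * Real.log p) := by
        rw [ha2]; field_simp
      have h2 : 0 < τ * Real.log p := by positivity
      rw [h1]; nlinarith)
  obtain ⟨emb, hemb⟩ := exists_embedding_avoiding (m := 1) (B := (p - 2) / 1) {i}
    (by rw [Finset.card_singleton]; omega)
  have ht : a ^ 2 ≤ δ := by
    have h1 : Real.log p / n ≤ C₀ := by
      rw [div_le_iff₀ hn0]
      nlinarith
    have h2 : 0 < τ * (Real.log p / n) := by positivity
    have h3 : τ * (Real.log p / n) ≤ τ * C₀ := by gcongr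
    rw [ha2, mul_div_assoc]
    linarith
  have : Nonempty (Fin ((p - 2) / 1)) := ⟨⟨0, hB⟩⟩
  let P : PerturbationFamily n p M k (Real.exp 4) (a ^ 2) (Fin 1 → Fin ((p - 2) / 1)) :=
    blockFamily (a := a) {i} (Finset.singleton_nonempty i) emb hemb hB
      (by rw [Finset.card_singleton]; omega) (by simp) (ht.trans hδ) (ht.trans hδ')
      (by simpa using hκ)
  refine P.le_matrixMinimaxProb hM (by omega) fun f => ⟨i, emb (0, f 0), ?_⟩
  refine lt_of_lt_of_le (by linarith : 2 * (a / 4) < a)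
    (le_abs_perturbedPrecision_sub_one_of_cross (sq_nonneg a) (ht.trans hδ')
      (indicatorVec_dotProduct_image_block hemb f) ha0.le (by simp) (hemb _) ?_ ?_)
  · intro h
    obtain ⟨l, -, hl⟩ := Finset.mem_image.1 h
    exact hemb (l, f l) (by simp [hl])
  · exact Finset.mem_image_of_mem (fun l => emb (l, f l)) (Finset.mem_univ 0)

end

theorem theorem5 (M ν C₀ : ℝ) (hM : 1 < M) (hν : 2 < ν) (hC₀ : 0 < C₀) :
    ∃ c₁ c₂ C₁ C₂ C₁' C₂' : ℝ,
      0 < c₁ ∧ 0 < c₂ ∧ 0 < C₁ ∧ 0 < C₂ ∧ 0 < C₁' ∧ 0 < C₂' ∧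
      ∀ n p k : ℕ, (k : ℝ) ^ ν ≤ (p : ℝ) → 3 ≤ k → (k : ℝ) ≤ C₀ * ((n : ℝ) / Real.log p) →
        (∀ i j : Fin p,
          ENNReal.ofReal c₁ <
            entryMinimaxProb n p M k i j
              (max (C₁ * ((k : ℝ) * Real.log p / n)) (C₂ * Real.sqrt (1 / n)))) ∧
        ENNReal.ofReal c₂ <
          matrixMinimaxProb n p M k
            (max (C₁' * ((k : ℝ) * Real.log p / n)) (C₂' * Real.sqrt (Real.log p / n))) := by
  obtain ⟨δ, hδ0, hδ, hδ'⟩ : ∃ δ : ℝ, 0 < δ ∧ δ ≤ (1 - 1 / M) ^ 2 ∧ δ ≤ 1 / 4 := by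
    have h1 : 1 / M < 1 := by rw [div_lt_one (by linarith)]; exact hM
    have h2 : 0 < 1 - 1 / M := by linarith
    exact ⟨min ((1 - 1 / M) ^ 2) (1 / 4), by positivity, min_le_left _ _, min_le_right _ _⟩
  obtain ⟨τ, hτ0, hτ, hτC, hτδ⟩ : ∃ τ : ℝ, 0 < τ ∧ τ ≤ (1 - 2 / ν) / 4 ∧ 2 * τ * C₀ ≤ δ ∧
      τ ≤ δ := by
    have h1 : 2 / ν < 1 := by rw [div_lt_one (by linarith)]; exact hν
    have h2 : 0 < 1 - 2 / ν := by linarith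
    refine ⟨min ((1 - 2 / ν) / 4) (min (δ / (2 * C₀)) δ), by positivity, min_le_left _ _, ?_,
      (min_le_right _ _).trans (min_le_right _ _)⟩
    have h3 : min ((1 - 2 / ν) / 4) (min (δ / (2 * C₀)) δ) ≤ δ / (2 * C₀) :=
      (min_le_right _ _).trans (min_le_left _ _)
    rw [le_div_iff₀ (by positivity)] at h3
    linarith
  have hc : ENNReal.ofReal (1 / (8 * Real.exp 4)) < ENNReal.ofReal (1 / (4 * Real.exp 4)) := by
    refine (ENNReal.ofReal_lt_ofReal_iff (by positivity)).2 ?_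
    gcongr
    norm_num
  refine ⟨1 / (8 * Real.exp 4), 1 / (8 * Real.exp 4), τ / 7, Real.sqrt τ / 4, τ / 7,
    Real.sqrt τ / 4, by positivity, by positivity, by positivity, by positivity, by positivity,
    by positivity, fun n p k hp hk hkn => ?_⟩
  have hp9 : 9 ≤ p := le_trans (by nlinarith) (sq_le_of_rpow_le hν (by omega) hp)
  have hlog : 0 < Real.log p := Real.log_pos (by exact_mod_cast (by omega : 1 < p))
  have hkn' : (k : ℝ) * Real.log p ≤ C₀ * n := by
    rwa [← mul_div_assoc, le_div_iff₀ hlog] at hkn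
  have hn : 0 < n := by
    rcases Nat.eq_zero_or_pos n with rfl | h
    · have h3 : (3 : ℝ) ≤ k := by exact_mod_cast hk
      simp at hkn
      linarith
    · exact h
  refine ⟨fun i j => hc.trans_le ?_, hc.trans_le ?_⟩
  · rcases max_choice (τ / 7 * ((k : ℝ) * Real.log p / n)) (Real.sqrt τ / 4 * Real.sqrt (1 / n))
      with h | h <;> rw [h]
    · exact (le_minimaxProb_logRate hM hν hδ hδ' hτ0 hτ hτC hn hp hk hkn' i j).1
    · exact le_entryMinimaxProb_parametricRate hM hτ0 (hτδ.trans hδ) (hτδ.trans hδ') hn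
        (by omega) i j
  · rcases max_choice (τ / 7 * ((k : ℝ) * Real.log p / n))
      (Real.sqrt τ / 4 * Real.sqrt (Real.log p / n)) with h | h <;> rw [h]
    · exact (le_minimaxProb_logRate hM hν hδ hδ' hτ0 hτ hτC hn hp hk hkn' ⟨0, by omega⟩
        ⟨0, by omega⟩).2
    · exact le_matrixMinimaxProb_sqrtLogRate hM hν hδ hδ' hτ0 hτ hτC hn hp hk hkn'
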